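/- Let $\Theta$ be a finite set, $\mathcal H,\mathcal K$ finite-dimensional complex Hilbert spaces, $u_\theta\in\mathcal H$ ($\theta\in\Theta$) vectors (not necessarily normalized), $L_\theta=|u_\theta\rangle\langle u_\theta|$, and let each $M_\theta$ be a nonnegative multiple of an orthogonal projector on $\mathcal K$, with $\|L_\theta\|=\|M_\theta\|$ (operator norm) for every $\theta$. Decompose $\Theta$ into components $\kappa$: $\theta$ and $\theta'$ belong to the same component iff there is a finite chain $\theta=\theta_1,\dots,\theta_k=\theta'$ ($k\ge 1$) with $L_{\theta_i}L_{\theta_{i+1}}\neq 0$ for $1\le i<k$; let $\kappa(\theta)$ denote the component of $\theta$. Call families $\{u_\theta\}_{\theta\in\Theta}$ and $\{v_\theta\}_{\theta\in\Theta}$ unitarily equivalent if there is a unitary $W:\mathrm{span}\{u_\theta\}\to\mathrm{span}\{v_\theta\}$ with $Wu_\theta=v_\theta$ for all $\theta$. Then there is a completely positive linear map $\Lambda:\mathcal L(\mathcal H)\to\mathcal L(\mathcal K)$ with $\Lambda(I_{\mathcal H})\le I_{\mathcal K}$ and $\Lambda(L_\theta)=M_\theta$ for all $\theta\in\Theta$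 if and only if there is a family $\mathcal V=\{v_\theta\}_{\theta\in\Theta}$ of vectors in some $\mathbb C^n$, unitarily equivalent to $\mathcal U=\{u_\theta\}_{\theta\in\Theta}$, and positive integers $d_\kappa$ such that, with respect to some isometric embedding of $\bigoplus_\kappa \mathcal V_\kappa\otimes\mathbb C^{d_\kappa}$ into $\mathcal K$, where $\mathcal V_\kappa=\mathrm{span}\{v_{\theta'}:\kappa(\theta')=\kappa\}$, $$M_\theta=|v_\theta\rangle\langle v_\theta|\otimes I_{d_{\kappa(\theta)}}\qquad(\theta\in\Theta),$$ that is, $M_\theta=J_{\kappa(\theta)}\,(|v_\theta\rangle\langle v_\theta|\otimes I_{d_{\kappa(\theta)}})\,J_{\kappa(\theta)}^\dagger$ for isometries $J_\kappa:\mathcal V_\kappa\otimes\mathbb C^{d_\kappa}\to\mathcal K$ with mutually orthogonal ranges. -/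

import Mathlib

open scoped TensorProduct CStarAlgebra

noncomputable section

namespace ObsConv

/-- Two indices are adjacent when they are distinct and the product of the corresponding operators
is nonzero (in one order; for self-adjoint operators the two orders are equivalent). -/
def productGraph {Θ A : Type*} [Mul A] [Zero A] (L : Θ → A) : SimpleGraph Θ :=
  SimpleGraph.fromRel fun a b => L a * L b ≠ 0

/-- The index set of the connected components `κ` of the family `L`: two indices lie in the same
component iff they are joined by a chain along which consecutive products are nonzero. -/
abbrev Component {Θ A : Type*} [Mul A] [Zero A] (L : Θ → A) : Type _ :=
  (productGraph L).ConnectedComponent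

/-- The component containing `θ`. -/
def component {Θ A : Type*} [Mul A] [Zero A] (L : Θ → A) (θ : Θ) : Component L :=
  (productGraph L).connectedComponentMk θ

/-- Two families of vectors are unitarily equivalent if a unitary operator between the subspaces
they span maps one family to the other. -/
def UnitarilyEquivalent {Θ E G : Type*} [NormedAddCommGroup E] [InnerProductSpace ℂ E]
    [NormedAddCommGroup G] [InnerProductSpace ℂ G] (u : Θ → E) (v : Θ → G) : Prop :=
  ∃ W : Submodule.span ℂ (Set.range u) ≃ₗᵢ[ℂ] Submodule.span ℂ (Set.range v),
    ∀ θ, (W ⟨u θ, Submodule.subset_span (Set.mem_range_self θ)⟩ : G) = v θ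

/-- The span of the vectors `v θ` with `θ` in the component `κ` of the family `L`. -/
def blockSpan {Θ A G : Type*} [Mul A] [Zero A] [NormedAddCommGroup G]
    [InnerProductSpace ℂ G]
    (L : Θ → A) (v : Θ → G) (κ : Component L) : Submodule ℂ G :=
  Submodule.span ℂ (v '' {θ | component L θ = κ})

/-- The vector `v θ`, as an element of the span of its block. -/
def blockVec {Θ A G : Type*} [Mul A] [Zero A] [NormedAddCommGroup G]
    [InnerProductSpace ℂ G]
    (L : Θ → A) (v : Θ → G) (θ : Θ) : blockSpan L v (component L θ) :=
  ⟨v θ, Submodule.subset_span ⟨θ, rfl, rfl⟩⟩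

/-- The operator `|x⟩⟨x| ⊗ I_d` on `E ⊗ ℂ^d`. -/
def rankOneTensorId {E : Type*} [NormedAddCommGroup E] [InnerProductSpace ℂ E] (x : E) (d : ℕ) :
    (E ⊗[ℂ] EuclideanSpace ℂ (Fin d)) →ₗ[ℂ] (E ⊗[ℂ] EuclideanSpace ℂ (Fin d)) :=
  TensorProduct.map (InnerProductSpace.rankOne ℂ x x : E →L[ℂ] E).toLinearMap LinearMap.id

/-- The operator `J T J†` on `K`: the operator `T` transported to the range of the isometry `J`,
extended by zero to the orthogonal complement of that range. -/
def embedOp {F K : Type*} [NormedAddCommGroup F] [InnerProductSpace ℂ F] [FiniteDimensional ℂ F]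
    [NormedAddCommGroup K] [InnerProductSpace ℂ K] [FiniteDimensional ℂ K]
    (J : F →ₗᵢ[ℂ] K) (T : F →ₗ[ℂ] F) : K →ₗ[ℂ] K :=
  J.toLinearMap ∘ₗ T ∘ₗ LinearMap.adjoint J.toLinearMap

end ObsConv

end

/-! ### Multiplicative domains and Kraus maps. -/

namespace CompletelyPositiveMap

variable {H K : Type*} [NormedAddCommGroup H] [InnerProductSpace ℂ H] [CompleteSpace H]
  [NormedAddCommGroup K] [InnerProductSpace ℂ K] [CompleteSpace K]

/-! Necessity is a multiplicative-domain argument. Equality of norms makes `Λ` send the projection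
onto each nonzero `u θ` to a projection, so by `map_mul_of_isStarProjection` `Λ` is multiplicative
against every `L θ`. This property passes to products, and a chain of nonzero overlaps then gives it
for `|u a⟩⟨u b|` whenever `a` and `b` share a component. These operators act as matrix units: with a
nonzero `u o` fixed in the component, `x ⊗ c ↦ ‖u o‖⁻¹ Λ(|x⟩⟨u o|) c`, for `c` in the range of `Λ (L
o)`, is an isometry that carries `|u θ⟩⟨u θ| ⊗ I` to `M θ` (`exists_block`). Across components `L θ
* L θ' = 0`, so `M θ * M θ' = 0` and the blocks are orthogonal.

Conversely, let `V κ` be the isometry taking `v θ` back to `u θ` on the block `κ`. The operators `J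
κ (· ⊗ e i) ∘ (V κ)†` are Kraus operators of the required map. Orthogonality of the ranges bounds
the image of the identity, and orthogonality of the vectors `u θ` across components removes the
cross terms. -/

lemma _root_.CStarMatrix.mul_apply_eq_sum {n A : Type*} [Fintype n] [NonUnitalCStarAlgebra A]
    (M N : CStarMatrix n n A) (i j : n) : (M * N) i j = ∑ k, M i k * N k j := rfl

lemma _root_.nonneg_iff_exists_star_mul_self {A : Type*} [NonUnitalCStarAlgebra A] [PartialOrder A]
    [StarOrderedRing A] {a : A} : 0 ≤ a ↔ ∃ b, a = star b * b :=
  CStarAlgebra.nonneg_iff_eq_star_mul_self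

lemma _root_.CStarMatrix.finsetSum_apply {n A ι : Type*} [NonUnitalCStarAlgebra A] (s : Finset ι)
    (g : ι → CStarMatrix n n A) (i j : n) : (∑ a ∈ s, g a) i j = ∑ a ∈ s, g a i j :=
  Matrix.sum_apply i j s g

/-- If `Λ (q† q)` has nonpositive expectation at `k`, then `Λ (x q)` annihilates `k` for all `x`. -/
lemma map_mul_apply_eq_zero (Λ : (H →L[ℂ] H) →CP (K →L[ℂ] K)) (x q : H →L[ℂ] H) (k : K)
    (hk : (inner ℂ k (Λ (star q * q) k)).re ≤ 0) : Λ (x * q) k = 0 := by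
  -- `star N * N` has off-diagonal entry `x * q` and lower corner `star q * q`. Writing its image
  -- under `Λ` as `B†B`, the hypothesis forces the second column of `B` to kill `k`, hence also the
  -- off-diagonal entry.
  let N : CStarMatrix (Fin 2) (Fin 2) (H →L[ℂ] H) :=
    CStarMatrix.ofMatrix !![star x, q; 0, 0]
  have h := Λ.map_cstarMatrix_nonneg (star N * N) (star_mul_self_nonneg N)
  obtain ⟨B, hB⟩ := nonneg_iff_exists_star_mul_self.mp h
  have h01 := congrFun (congrFun hB 0) 1
  have h11 := congrFun (congrFun hB 1) 1
  simp only [CStarMatrix.map_apply, CStarMatrix.mul_apply_eq_sum, Fin.sum_univ_two,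
    CStarMatrix.star_apply] at h01 h11
  have e0 : N 0 0 = star x := rfl
  have e1 : N 0 1 = q := rfl
  have e2 : N 1 0 = 0 := rfl
  have e3 : N 1 1 = 0 := rfl
  simp only [e0, e1, e2, e3, star_star, mul_zero, add_zero] at h01 h11
  rw [h11] at hk
  have key (b : K →L[ℂ] K) : inner ℂ k ((star b * b) k) = ((‖b k‖ ^ 2 : ℝ) : ℂ) := by
    rw [mul_apply_eq_comp, ContinuousLinearMap.star_eq_adjoint,
      ContinuousLinearMap.adjoint_inner_right, inner_self_eq_norm_sq_to_K]
    simp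
  rw [add_apply, inner_add_right, key, key, ← Complex.ofReal_add,
    Complex.ofReal_re] at hk
  have b0 : B 0 1 k = 0 := by
    rw [← norm_eq_zero, ← sq_eq_zero_iff]; nlinarith [sq_nonneg ‖B 0 1 k‖, sq_nonneg ‖B 1 1 k‖]
  have b1 : B 1 1 k = 0 := by
    rw [← norm_eq_zero, ← sq_eq_zero_iff]; nlinarith [sq_nonneg ‖B 0 1 k‖, sq_nonneg ‖B 1 1 k‖]
  rw [h01]
  simp [b0, b1]

/-- A contractive completely positive map that sends a projection `p` to a projection is
multiplicative on products with right factor `p`. -/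
lemma map_mul_of_isStarProjection (Λ : (H →L[ℂ] H) →CP (K →L[ℂ] K)) (hΛ : Λ 1 ≤ 1)
    {p : H →L[ℂ] H} (hp : IsStarProjection p) (hΛp : IsStarProjection (Λ p)) (x : H →L[ℂ] H) :
    Λ (x * p) = Λ x * Λ p := by
  have hpp : star p * p = p := by rw [hp.isSelfAdjoint.star_eq, hp.isIdempotentElem.eq]
  have hq := hp.one_sub
  have hqq : star (1 - p) * (1 - p) = 1 - p := by
    rw [hq.isSelfAdjoint.star_eq, hq.isIdempotentElem.eq]
  have idem (k : K) : Λ p (Λ p k) = Λ p k := by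
    conv_rhs => rw [← hΛp.isIdempotentElem.eq]
    rfl
  ext k
  -- Split `k` along `Λ p`: on its kernel `Λ p` has zero expectation, and on its range `Λ (1 - p) ≤
  -- 1 - Λ p` does not have positive expectation.
  have h1 : Λ (x * p) (k - Λ p k) = 0 := by
    apply map_mul_apply_eq_zero
    rw [hpp, map_sub, idem, sub_self, inner_zero_right]
    simp
  have h2 : Λ (x * (1 - p)) (Λ p k) = 0 := by
    apply map_mul_apply_eq_zero
    rw [hqq, map_sub, sub_apply, idem, inner_sub_right]
    have := ((ContinuousLinearMap.le_def _ _).mp hΛ).re_inner_nonneg_right (Λ p k)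
    simpa [inner_sub_right] using this
  rw [map_sub, sub_eq_zero] at h1
  rw [mul_sub, mul_one, map_sub, sub_apply, sub_eq_zero] at h2
  rw [mul_apply_eq_comp, h1, h2]

/-- The map `X ↦ A X A†` is completely positive. -/
lemma map_conj_nonneg (A : H →L[ℂ] K) {n : Type*} [Fintype n] (M : CStarMatrix n n (H →L[ℂ] H))
    (hM : 0 ≤ M) [FiniteDimensional ℂ H] :
    0 ≤ M.map fun x => A ∘L x ∘L ContinuousLinearMap.adjoint A := by
  classical
  obtain ⟨B, rfl⟩ := nonneg_iff_exists_star_mul_self.mp hM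
  rcases subsingleton_or_nontrivial K with hK | hK
  · have : (star B * B).map (fun x => A ∘L x ∘L ContinuousLinearMap.adjoint A) = 0 := by
      ext i j k
      exact Subsingleton.elim _ _
    exact this.ge
  obtain ⟨f, hf⟩ := exists_norm_eq K (zero_le_one (α := ℝ))
  let e := stdOrthonormalBasis ℂ H
  -- The natural factor `B k j ∘ A†` maps `K` to `H`, while squares are needed in matrices over
  -- operators on `K`. The `S m` carry `H` into the line of `f`, and `∑ S m† S m = 1` means nothing
  -- is lost.
  let S (m) : H →L[ℂ] K := InnerProductSpace.rankOne ℂ f (e m)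
  have hS : ∑ m, (ContinuousLinearMap.adjoint (S m)) ∘L S m = 1 := by
    rw [← ContinuousLinearMap.coe_inj]
    simp [S, InnerProductSpace.rankOne_comp_rankOne, hf, e.sum_rankOne_eq_id]
    rfl
  rcases isEmpty_or_nonempty n with hn | ⟨⟨o⟩⟩
  · have : (star B * B).map (fun x => A ∘L x ∘L ContinuousLinearMap.adjoint A) = 0 := by
      ext i; exact isEmptyElim i
    exact this.ge
  let Z (k : n) (m) : CStarMatrix n n (K →L[ℂ] K) := CStarMatrix.ofMatrix fun i j =>
    if i = o then S m ∘L B k j ∘L ContinuousLinearMap.adjoint A else 0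
  have : (star B * B).map (fun x => A ∘L x ∘L ContinuousLinearMap.adjoint A)
      = ∑ k, ∑ m, star (Z k m) * Z k m := by
    have Z_apply (k : n) (m) (i j : n) : Z k m i j =
        if i = o then S m ∘L B k j ∘L ContinuousLinearMap.adjoint A else 0 := rfl
    have entry (k : n) (m) (i j : n) : (star (Z k m) * Z k m) i j =
        A ∘L (ContinuousLinearMap.adjoint (B k i) ∘L
          (ContinuousLinearMap.adjoint (S m) ∘L S m) ∘L B k j) ∘L ContinuousLinearMap.adjoint A := by
      rw [CStarMatrix.mul_apply_eq_sum, Finset.sum_eq_single o]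
      · rw [CStarMatrix.star_apply, Z_apply, Z_apply, if_pos rfl, if_pos rfl]
        simp only [ContinuousLinearMap.star_eq_adjoint, ContinuousLinearMap.adjoint_comp,
          ContinuousLinearMap.adjoint_adjoint, ContinuousLinearMap.mul_def]
        rfl
      · intro l _ hl
        rw [Z_apply k m l j, if_neg hl, mul_zero]
      · simp
    have sumS (X Y : H →L[ℂ] H) : ∑ m, X ∘L (ContinuousLinearMap.adjoint (S m) ∘L S m) ∘L Y
        = X ∘L Y := by
      have := congrArg (fun T => X ∘L T ∘L Y) hS
      rwa [ContinuousLinearMap.finsetSum_comp, ContinuousLinearMap.comp_finsetSum] at this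
    ext1 i j
    rw [CStarMatrix.map_apply, CStarMatrix.mul_apply_eq_sum, CStarMatrix.finsetSum_apply, ContinuousLinearMap.finsetSum_comp,
      ContinuousLinearMap.comp_finsetSum]
    refine Finset.sum_congr rfl fun k _ => ?_
    rw [CStarMatrix.finsetSum_apply, Finset.sum_congr rfl fun m _ => entry k m i j,
      ← ContinuousLinearMap.comp_finsetSum, ← ContinuousLinearMap.finsetSum_comp, sumS]
    rfl
  rw [this]
  exact Finset.sum_nonneg fun k _ => Finset.sum_nonneg fun m _ => star_mul_self_nonneg _

/-- The completely positive map `X ↦ ∑ i, A i X (A i)†`. -/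
noncomputable def ofKraus [FiniteDimensional ℂ H] {ι : Type*} [Fintype ι] (A : ι → H →L[ℂ] K) :
    (H →L[ℂ] H) →CP (K →L[ℂ] K) where
  toFun x := ∑ i, A i ∘L x ∘L ContinuousLinearMap.adjoint (A i)
  map_add' x y := by
    simp [ContinuousLinearMap.add_comp, ContinuousLinearMap.comp_add, Finset.sum_add_distrib]
  map_smul' c x := by
    simp [ContinuousLinearMap.smul_comp, Finset.smul_sum]
  map_cstarMatrix_nonneg' k M hM := by
    have : 0 ≤ ∑ i, M.map fun x => A i ∘L x ∘L ContinuousLinearMap.adjoint (A i) :=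
      Finset.sum_nonneg fun i _ => map_conj_nonneg (A i) M hM
    convert this using 1
    ext1 a b
    rw [CStarMatrix.finsetSum_apply]
    rfl

lemma ofKraus_apply [FiniteDimensional ℂ H] {ι : Type*} [Fintype ι] (A : ι → H →L[ℂ] K)
    (x : H →L[ℂ] H) : ofKraus A x = ∑ i, A i ∘L x ∘L ContinuousLinearMap.adjoint (A i) := rfl

end CompletelyPositiveMap

/-! ### Tensor isometries and rank-one operators. -/

namespace ObsConv

open InnerProductSpace (rankOne)

lemma block_tensor_induction {Θ A G F : Type*} [Mul A] [Zero A] [NormedAddCommGroup G]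
    [InnerProductSpace ℂ G] [AddCommGroup F] [Module ℂ F] (L : Θ → A) (v : Θ → G)
    (κ : Component L)
    {p : blockSpan L v κ ⊗[ℂ] F → Prop} (zero : p 0) (add : ∀ x y, p x → p y → p (x + y))
    (tmul : ∀ (θ : Θ) (h : component L θ = κ) (c : F),
      p (⟨v θ, Submodule.subset_span ⟨θ, h, rfl⟩⟩ ⊗ₜ c))
    (z : blockSpan L v κ ⊗[ℂ] F) : p z := by
  induction z using TensorProduct.induction_on with
  | zero => exact zero
  | add x y hx hy => exact add x y hx hy
  | tmul x c =>
    obtain ⟨x, hx⟩ := x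
    revert c
    induction hx using Submodule.span_induction with
    | mem x h => obtain ⟨θ, h, rfl⟩ := h; exact tmul θ h
    | zero => intro c; convert zero; exact TensorProduct.zero_tmul _ _
    | add x y hx hy h1 h2 =>
      intro c
      convert add _ _ (h1 c) (h2 c)
      rw [← TensorProduct.add_tmul]; rfl
    | smul a x hx h =>
      intro c
      convert h (a • c) using 1
      rw [← TensorProduct.smul_tmul]; rfl

section

variable {E F K : Type*} [NormedAddCommGroup E] [InnerProductSpace ℂ E]
  [NormedAddCommGroup F] [InnerProductSpace ℂ F] [NormedAddCommGroup K] [InnerProductSpace ℂ K]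

/-- The isometry `E ⊗ F → K` induced by a bilinear map compatible with the inner products. -/
noncomputable def tensorIsometry (B : E →ₗ[ℂ] F →ₗ[ℂ] K)
    (h : ∀ x c y c', inner ℂ (B x c) (B y c') = (inner ℂ x y * inner ℂ c c' : ℂ)) :
    E ⊗[ℂ] F →ₗᵢ[ℂ] K :=
  (TensorProduct.lift B).isometryOfInner fun z w => by
    induction z using TensorProduct.induction_on with
    | zero => simp
    | add z1 z2 h1 h2 => rw [map_add, inner_add_left, h1, h2, inner_add_left]
    | tmul x c =>
      induction w using TensorProduct.induction_on with
      | zero => simp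
      | add z1 z2 h1 h2 => rw [map_add, inner_add_right, h1, h2, inner_add_right]
      | tmul y c' => simp [h]

lemma tensorIsometry_tmul (B : E →ₗ[ℂ] F →ₗ[ℂ] K)
    (h : ∀ x c y c', inner ℂ (B x c) (B y c') = (inner ℂ x y * inner ℂ c c' : ℂ)) (x : E) (c : F) :
    tensorIsometry B h (x ⊗ₜ c) = B x c := TensorProduct.lift.tmul x c

end

lemma rankOneTensorId_zero (E : Type*) [NormedAddCommGroup E] [InnerProductSpace ℂ E] (d : ℕ) :
    rankOneTensorId (0 : E) d = 0 := by
  simp [rankOneTensorId]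

lemma rankOne_mul_rankOne {H : Type*} [NormedAddCommGroup H] [InnerProductSpace ℂ H]
    (x y z w : H) :
    rankOne ℂ x y * rankOne ℂ z w = (inner ℂ y z : ℂ) • rankOne ℂ x w := by
  rw [ContinuousLinearMap.mul_def, InnerProductSpace.rankOne_comp_rankOne]

/-! ### Necessity: matrix units inside one component. -/

section Forward

variable {Θ H K : Type*} [NormedAddCommGroup H] [InnerProductSpace ℂ H] [CompleteSpace H]
  [NormedAddCommGroup K] [InnerProductSpace ℂ K] [CompleteSpace K]

/-- `a` is in the right multiplicative domain of `Λ`. -/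
def MulRight (Λ : (H →L[ℂ] H) →CP (K →L[ℂ] K)) (a : H →L[ℂ] H) : Prop :=
  ∀ x, Λ (x * a) = Λ x * Λ a

lemma MulRight.mul {Λ : (H →L[ℂ] H) →CP (K →L[ℂ] K)} {a b : H →L[ℂ] H} (ha : MulRight Λ a)
    (hb : MulRight Λ b) : MulRight Λ (a * b) := fun x => by
  rw [← mul_assoc, hb, ha, hb, mul_assoc]

lemma MulRight.add {Λ : (H →L[ℂ] H) →CP (K →L[ℂ] K)} {a b : H →L[ℂ] H} (ha : MulRight Λ a)
    (hb : MulRight Λ b) : MulRight Λ (a + b) := fun x => by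
  rw [mul_add, map_add, ha, hb, map_add, mul_add]

lemma MulRight.smul {Λ : (H →L[ℂ] H) →CP (K →L[ℂ] K)} {a : H →L[ℂ] H} (c : ℂ)
    (ha : MulRight Λ a) : MulRight Λ (c • a) := fun x => by
  rw [mul_smul_comm, map_smul, ha, map_smul, mul_smul_comm]

lemma MulRight.zero (Λ : (H →L[ℂ] H) →CP (K →L[ℂ] K)) : MulRight Λ 0 := fun x => by
  simp

/-- Comparing norms gives `c = ‖u‖ ^ 2` when `u ≠ 0`, so the projection onto the line of `u` is sent
exactly to `P`. -/
lemma mulRight_rankOne_self {Λ : (H →L[ℂ] H) →CP (K →L[ℂ] K)} (hΛ : Λ 1 ≤ 1) (u : H)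
    (hM : ∃ (c : ℝ) (P : K →L[ℂ] K), 0 ≤ c ∧ IsStarProjection P ∧
      Λ (rankOne ℂ u u) = (c : ℂ) • P)
    (hnorm : ‖(rankOne ℂ u u : H →L[ℂ] H)‖ = ‖Λ (rankOne ℂ u u)‖) :
    MulRight Λ (rankOne ℂ u u) := by
  by_cases hu : u = 0
  · subst hu
    simpa using MulRight.zero Λ
  obtain ⟨c, P, hc, hP, hcP⟩ := hM
  rw [InnerProductSpace.norm_rankOne, hcP, norm_smul, Complex.norm_real, Real.norm_of_nonneg hc]
    at hnorm
  have hP0 : P ≠ 0 := by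
    rintro rfl
    simp [hu] at hnorm
  have hP1 : ‖P‖ = 1 := by
    have h := CStarRing.norm_star_mul_self (x := P)
    rw [hP.isSelfAdjoint.star_eq, hP.isIdempotentElem.eq] at h
    exact (mul_eq_left₀ (norm_ne_zero_iff.mpr hP0)).mp h.symm
  rw [hP1, mul_one] at hnorm
  have hp : IsStarProjection (rankOne ℂ ((‖u‖ : ℂ)⁻¹ • u) ((‖u‖ : ℂ)⁻¹ • u) : H →L[ℂ] H) :=
    InnerProductSpace.isStarProjection_rankOne_self (by simp [norm_smul, hu])
  have hcu : (c : ℂ) ≠ 0 := by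
    rw [← hnorm]; simp [hu]
  have e : (rankOne ℂ u u : H →L[ℂ] H) =
      (c : ℂ) • rankOne ℂ ((‖u‖ : ℂ)⁻¹ • u) ((‖u‖ : ℂ)⁻¹ • u) := by
    have : (‖u‖ : ℂ) ≠ 0 := by simpa using hu
    simp only [map_smul, map_smulₛₗ, smul_smul, smul_apply, ← hnorm]
    simp
    field_simp
    simp
  have hΛp : Λ (rankOne ℂ ((‖u‖ : ℂ)⁻¹ • u) ((‖u‖ : ℂ)⁻¹ • u)) = P := by
    rw [e, map_smul] at hcP
    exact smul_right_injective _ hcu hcP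
  have := CompletelyPositiveMap.map_mul_of_isStarProjection Λ hΛ hp (by rwa [hΛp])
  rw [e]
  exact MulRight.smul _ this

/-- Along a chain, `|u a⟩⟨u b| * L c` is `⟨u b, u c⟩ |u a⟩⟨u c|`, and the overlap is invertible at
each edge. -/
lemma mulRight_rankOne_of_reachable {Λ : (H →L[ℂ] H) →CP (K →L[ℂ] K)} {u : Θ → H}
    {L : Θ → H →L[ℂ] H} (hL : ∀ θ, L θ = rankOne ℂ (u θ) (u θ))
    (h : ∀ θ, MulRight Λ (L θ)) {a b : Θ} (hab : (productGraph L).Reachable a b) :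
    MulRight Λ (rankOne ℂ (u a) (u b)) := by
  rw [SimpleGraph.reachable_iff_reflTransGen] at hab
  induction hab with
  | refl => exact hL a ▸ h a
  | @tail b c _ hbc ih =>
    have hin : (inner ℂ (u b) (u c) : ℂ) ≠ 0 := by
      rw [productGraph, SimpleGraph.fromRel_adj] at hbc
      rcases hbc.2 with h | h <;> rw [hL, hL, rankOne_mul_rankOne] at h
      · exact (smul_ne_zero_iff.mp h).1
      · exact fun h0 => (smul_ne_zero_iff.mp h).1 (inner_eq_zero_symm.mp h0)
    have := (ih.mul (h c)).smul (inner ℂ (u b) (u c) : ℂ)⁻¹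
    rwa [hL, rankOne_mul_rankOne, smul_smul, inv_mul_cancel₀ hin, one_smul] at this

/-- A symmetric operator with range inside that of `J` vanishes on the orthogonal complement, so its
action on the range of `J` determines it. -/
lemma eq_embedOp {F K : Type*} [NormedAddCommGroup F] [InnerProductSpace ℂ F]
    [FiniteDimensional ℂ F] [NormedAddCommGroup K] [InnerProductSpace ℂ K] [FiniteDimensional ℂ K]
    (J : F →ₗᵢ[ℂ] K) (T : F →ₗ[ℂ] F) (M : K →ₗ[ℂ] K) (hM : M.IsSymmetric)
    (hJ : ∀ z, M (J z) = J (T z)) (hr : ∀ k, ∃ z, M k = J z) : M = embedOp J T := by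
  ext k
  have h0 : M (k - J (LinearMap.adjoint J.toLinearMap k)) = 0 := by
    refine ext_inner_left ℂ fun y => ?_
    obtain ⟨z, hz⟩ := hr y
    rw [← hM, hz, inner_zero_right, inner_sub_right, J.inner_map_map,
      LinearMap.adjoint_inner_right]
    exact sub_self _
  rw [map_sub, sub_eq_zero, hJ] at h0
  exact h0

lemma exists_block [FiniteDimensional ℂ K] {G : Type*} [NormedAddCommGroup G]
    [InnerProductSpace ℂ G] [FiniteDimensional ℂ G]
    {Λ : (H →L[ℂ] H) →CP (K →L[ℂ] K)} {u : Θ → H}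
    {L : Θ → H →L[ℂ] H} (hL : ∀ θ, L θ = rankOne ℂ (u θ) (u θ))
    (hdom : ∀ θ, MulRight Λ (L θ)) (h0 : ∀ θ, Λ (L θ) = 0 → u θ = 0)
    (T : H ≃ₗᵢ[ℂ] G) (κ : Component L) :
    ∃ (d : ℕ) (J : blockSpan L (fun θ => T (u θ)) κ ⊗[ℂ] EuclideanSpace ℂ (Fin d) →ₗᵢ[ℂ] K),
      0 < d ∧ ∀ θ (h : component L θ = κ), (Λ (L θ)).toLinearMap =
        embedOp J (rankOneTensorId
          (⟨T (u θ), Submodule.subset_span ⟨θ, h, rfl⟩⟩ : blockSpan L (fun θ => T (u θ)) κ) d) := by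
  -- If the component contains only zero vectors, its span is zero; any positive multiplicity works,
  -- and 1 is chosen.
  by_cases hκ : ∀ θ, component L θ = κ → u θ = 0
  · have hz (x : blockSpan L (fun θ => T (u θ)) κ) : x = 0 := by
      obtain ⟨x, hx⟩ := x
      have : blockSpan L (fun θ => T (u θ)) κ = ⊥ := by
        rw [blockSpan, Submodule.span_eq_bot]
        rintro _ ⟨θ, h, rfl⟩
        simp [hκ θ h]
      rw [this, Submodule.mem_bot] at hx
      exact Subtype.ext hx
    refine ⟨1, tensorIsometry 0 fun x c y c' => by simp [hz x], one_pos, fun θ h => ?_⟩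
    have hM0 : Λ (L θ) = 0 := by rw [hL, hκ θ h]; simp
    rw [hM0, hz ⟨T (u θ), Submodule.subset_span ⟨θ, h, rfl⟩⟩]
    refine eq_embedOp _ _ _ (fun x y => by simp) (fun z => ?_) fun k => ⟨0, by simp⟩
    rw [rankOneTensorId_zero]
    simp
  push Not at hκ
  obtain ⟨o, rfl, ho⟩ := hκ
  have hnz : (‖u o‖ : ℂ) ≠ 0 := by simpa using ho
  have hMo (k : K) : Λ (L o) (Λ (L o) k) = ((‖u o‖ : ℂ) ^ 2) • Λ (L o) k := by
    have := hdom o (L o)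
    rw [hL, rankOne_mul_rankOne, map_smul, inner_self_eq_norm_sq_to_K] at this
    rw [hL]
    exact (DFunLike.congr_fun this k).symm
  let R := LinearMap.range (Λ (L o)).toLinearMap
  have hR (r : R) : Λ (L o) r = ((‖u o‖ : ℂ) ^ 2) • (r : K) := by
    obtain ⟨_, k, rfl⟩ := r
    exact hMo k
  let e := stdOrthonormalBasis ℂ R
  have hd : 0 < Module.finrank ℂ R := by
    rw [Module.finrank_pos_iff, Submodule.nontrivial_iff_ne_bot, Ne, LinearMap.range_eq_bot]
    intro h
    refine ho (h0 o ?_)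
    ext k
    exact DFunLike.congr_fun h k
  have hX (x : blockSpan L (fun θ => T (u θ)) (component L o)) :
      MulRight Λ (rankOne ℂ (T.symm x) (u o)) := by
    obtain ⟨x, hx⟩ := x
    induction hx using Submodule.span_induction with
    | mem x h =>
      obtain ⟨θ, h, rfl⟩ := h
      simpa using mulRight_rankOne_of_reachable hL hdom (SimpleGraph.ConnectedComponent.exact h)
    | zero => simpa using MulRight.zero Λ
    | add x y hx hy h1 h2 => simpa using h1.add h2
    | smul a x hx h => simpa using h.smul a
  -- `Λ (L o)` acts as `‖u o‖ ^ 2` on its range `R`; the factor `‖u o‖⁻¹` compensates for this in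
  -- inner products.
  let B : blockSpan L (fun θ => T (u θ)) (component L o) →ₗ[ℂ]
      EuclideanSpace ℂ (Fin (Module.finrank ℂ R)) →ₗ[ℂ] K :=
    LinearMap.mk₂ ℂ
      (fun x c => (‖u o‖ : ℂ)⁻¹ • Λ (rankOne ℂ (T.symm x) (u o)) (e.repr.symm c : K))
      (fun x y c => by simp)
      (fun a x c => by simp [smul_comm a])
      (fun x c c' => by simp)
      (fun a x c => by simp [smul_comm a])
  have hB x c : B x c = (‖u o‖ : ℂ)⁻¹ • Λ (rankOne ℂ (T.symm x) (u o)) (e.repr.symm c : K) := rfl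
  have hstar (x y : H) : ContinuousLinearMap.adjoint (Λ (rankOne ℂ x y)) = Λ (rankOne ℂ y x) := by
    rw [← ContinuousLinearMap.star_eq_adjoint, ← map_star, ContinuousLinearMap.star_eq_adjoint,
      InnerProductSpace.adjoint_rankOne]
  have hinner x c y c' : inner ℂ (B x c) (B y c') = (inner ℂ x y * inner ℂ c c' : ℂ) := by
    have h1 : Λ (rankOne ℂ (u o) (T.symm x)) (Λ (rankOne ℂ (T.symm y) (u o)) (e.repr.symm c' : K))
        = ((inner ℂ x y : ℂ) * (‖u o‖ : ℂ) ^ 2) • (e.repr.symm c' : K) := by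
      have := hX y (rankOne ℂ (u o) (T.symm x))
      rw [rankOne_mul_rankOne, map_smul, ← hL, LinearIsometryEquiv.inner_map_map] at this
      rw [mul_smul, ← hR]
      exact (DFunLike.congr_fun this _).symm
    rw [hB, hB, inner_smul_left, inner_smul_right, ← ContinuousLinearMap.adjoint_inner_right,
      hstar, h1, inner_smul_right, ← Submodule.coe_inner, LinearIsometryEquiv.inner_map_map]
    simp only [map_inv₀, Complex.conj_ofReal]
    field_simp
  let J := tensorIsometry B hinner
  have hJ x c : J (x ⊗ₜ c) = B x c := tensorIsometry_tmul B hinner x c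
  refine ⟨_, J, hd, fun θ h => eq_embedOp _ _ _ ?_ ?_ ?_⟩
  · intro x y
    have := hstar (u θ) (u θ)
    rw [← hL] at this
    conv_lhs => rw [← this]
    exact ContinuousLinearMap.adjoint_inner_left _ _ _
  · intro z
    induction z using TensorProduct.induction_on with
    | zero => simp
    | add z1 z2 h1 h2 => simp only [map_add, h1, h2]
    | tmul x c =>
      have := hX x (L θ)
      rw [hL, rankOne_mul_rankOne, map_smul, ← hL] at this
      have hT : rankOneTensorId (⟨T (u θ), Submodule.subset_span ⟨θ, h, rfl⟩⟩ :
          blockSpan L (fun θ => T (u θ)) (component L o)) _ (x ⊗ₜ[ℂ] c) =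
          (inner ℂ (u θ) (T.symm x) : ℂ) • ((⟨T (u θ), Submodule.subset_span ⟨θ, h, rfl⟩⟩ :
          blockSpan L (fun θ => T (u θ)) (component L o)) ⊗ₜ[ℂ] c) := by
        rw [← T.inner_map_map, T.apply_symm_apply]
        rfl
      rw [hT, map_smul, hJ, hJ, hB, hB, map_smul, smul_comm]
      congr 1
      rw [T.symm_apply_apply]
      exact (DFunLike.congr_fun this _).symm
  · intro k
    have hθo := mulRight_rankOne_of_reachable hL hdom
      (SimpleGraph.ConnectedComponent.exact h).symm
    -- Since `|u θ⟩⟨u o| * |u o⟩⟨u θ| = ‖u o‖ ^ 2 • L θ`, this vector of `R` is the multiplicity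
    -- component of `Λ (L θ) k`.
    have hmem : (‖u o‖ : ℂ)⁻¹ • Λ (rankOne ℂ (u o) (u θ)) k ∈ R := by
      have := DFunLike.congr_fun (hθo (L o)) k
      rw [hL, rankOne_mul_rankOne, map_smul, ← hL, inner_self_eq_norm_sq_to_K] at this
      have h2 : Λ (L o) (Λ (rankOne ℂ (u o) (u θ)) k) =
        ((‖u o‖ : ℂ) ^ 2) • Λ (rankOne ℂ (u o) (u θ)) k := this.symm
      refine ⟨((‖u o‖ : ℂ) ^ 3)⁻¹ • Λ (rankOne ℂ (u o) (u θ)) k, ?_⟩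
      rw [map_smul]
      refine (congrArg _ h2).trans ?_
      rw [smul_smul]
      congr 1
      field_simp
    refine ⟨⟨T (u θ), Submodule.subset_span ⟨θ, h, rfl⟩⟩ ⊗ₜ e.repr ⟨_, hmem⟩, ?_⟩
    rw [hJ, hB, T.symm_apply_apply, e.repr.symm_apply_apply]
    have := DFunLike.congr_fun (hθo (rankOne ℂ (u θ) (u o))) k
    rw [rankOne_mul_rankOne, map_smul, ← hL, inner_self_eq_norm_sq_to_K] at this
    have h2 : Λ (rankOne ℂ (u θ) (u o)) (Λ (rankOne ℂ (u o) (u θ)) k) =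
      ((‖u o‖ : ℂ) ^ 2) • Λ (L θ) k := this.symm
    rw [map_smul, h2, smul_smul, smul_smul, show (‖u o‖ : ℂ)⁻¹ * (‖u o‖ : ℂ)⁻¹ * (‖u o‖ : ℂ) ^ 2 = 1
      by field_simp, one_smul]
    rfl

end Forward

lemma unitarilyEquivalent_comp {Θ H G : Type*} [NormedAddCommGroup H] [InnerProductSpace ℂ H]
    [NormedAddCommGroup G] [InnerProductSpace ℂ G] (u : Θ → H) (T : H ≃ₗᵢ[ℂ] G) :
    UnitarilyEquivalent u (fun θ => T (u θ)) := by
  have h : (Submodule.span ℂ (Set.range u)).map (T.toLinearEquiv : H →ₗ[ℂ] G) =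
      Submodule.span ℂ (Set.range fun θ => T (u θ)) := by
    rw [Submodule.map_span, ← Set.range_comp]; rfl
  exact ⟨(T.submoduleMap _).trans (LinearIsometryEquiv.ofEq _ _ h), fun θ => rfl⟩

/-! ### Rank-one expansion of the embedded blocks. -/

section Embed

variable {E F K : Type*} [NormedAddCommGroup E] [InnerProductSpace ℂ E]
  [NormedAddCommGroup F] [InnerProductSpace ℂ F]
  [NormedAddCommGroup K] [InnerProductSpace ℂ K]

/-- The isometry `x ↦ J (x ⊗ f)` for a unit vector `f`. -/
noncomputable def sliceIsometry (J : E ⊗[ℂ] F →ₗᵢ[ℂ] K) (f : F) (hf : ‖f‖ = 1) : E →ₗᵢ[ℂ] K where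
  toFun x := J (x ⊗ₜ f)
  map_add' x y := by rw [TensorProduct.add_tmul, map_add]
  map_smul' c x := by rw [← TensorProduct.smul_tmul', map_smul]; rfl
  norm_map' x := by simp [hf]

lemma inner_map_tmul (J : E ⊗[ℂ] F →ₗᵢ[ℂ] K) (x y : E) (f g : F) :
    inner ℂ (J (x ⊗ₜ f)) (J (y ⊗ₜ g)) = (inner ℂ x y * inner ℂ f g : ℂ) := by
  rw [LinearIsometry.inner_map_map, TensorProduct.inner_tmul]

variable [FiniteDimensional ℂ K]

lemma embedOp_apply_apply [FiniteDimensional ℂ F] (J : F →ₗᵢ[ℂ] K) (T : F →ₗ[ℂ] F) (z : F) :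
    embedOp J T (J z) = J (T z) := by
  have : LinearMap.adjoint J.toLinearMap (J z) = z := by
    refine ext_inner_left ℂ fun y => ?_
    rw [LinearMap.adjoint_inner_right]
    exact J.inner_map_map y z
  exact congrArg (fun w => J (T w)) this

/-- For `x ≠ 0`, `x ⊗ c` is an eigenvector with eigenvalue `‖x‖ ^ 2`. This places generators of a
block in the ranges of the `M θ`. -/
lemma exists_embedOp_eq [FiniteDimensional ℂ E] {d : ℕ}
    (J : E ⊗[ℂ] EuclideanSpace ℂ (Fin d) →ₗᵢ[ℂ] K) (x : E) (c : EuclideanSpace ℂ (Fin d)) :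
    ∃ a, J (x ⊗ₜ c) = embedOp J (rankOneTensorId x d) a := by
  by_cases hx : x = 0
  · exact ⟨0, by simp [hx]⟩
  have hx' : (‖x‖ : ℂ) ≠ 0 := by simpa using hx
  refine ⟨J (((‖x‖ : ℂ) ^ 2)⁻¹ • (x ⊗ₜ c)), ?_⟩
  rw [embedOp_apply_apply, map_smul]
  congr 1
  have : rankOneTensorId x d (x ⊗ₜ[ℂ] c) = ((‖x‖ : ℂ) ^ 2) • (x ⊗ₜ[ℂ] c) := by
    simp only [rankOneTensorId, TensorProduct.map_tmul, ContinuousLinearMap.coe_coe,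
      InnerProductSpace.rankOne_apply, inner_self_eq_norm_sq_to_K, LinearMap.id_apply,
      TensorProduct.smul_tmul']
    rfl
  rw [this, smul_smul, inv_mul_cancel₀ (pow_ne_zero 2 hx'), one_smul]

lemma embedOp_rankOneTensorId [FiniteDimensional ℂ E] {d : ℕ}
    (J : E ⊗[ℂ] EuclideanSpace ℂ (Fin d) →ₗᵢ[ℂ] K) (x : E) :
    embedOp J (rankOneTensorId x d) = (∑ i, rankOne ℂ
      (J (x ⊗ₜ EuclideanSpace.single i 1)) (J (x ⊗ₜ EuclideanSpace.single i 1)) :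
        K →L[ℂ] K).toLinearMap := by
  have key (z : E ⊗[ℂ] EuclideanSpace ℂ (Fin d)) : rankOneTensorId x d z =
      ∑ i, (inner ℂ (x ⊗ₜ EuclideanSpace.single i 1) z : ℂ) •
        (x ⊗ₜ[ℂ] EuclideanSpace.single i (1 : ℂ)) := by
    induction z using TensorProduct.induction_on with
    | zero => simp
    | add a b ha hb => simp only [map_add, ha, hb, inner_add_right, add_smul, Finset.sum_add_distrib]
    | tmul y c =>
      have hc : c = ∑ i, c i • EuclideanSpace.single i (1 : ℂ) := by
        ext j; simp [Finset.sum_apply, Pi.single_apply]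
      simp only [TensorProduct.inner_tmul, mul_smul, ← Finset.smul_sum]
      simp only [EuclideanSpace.inner_single_left, map_one, one_mul, ← TensorProduct.tmul_smul,
        ← TensorProduct.tmul_sum]
      rw [← hc]
      simp [rankOneTensorId, TensorProduct.smul_tmul']
  ext k
  have h1 : embedOp J (rankOneTensorId x d) k =
    J (rankOneTensorId x d (LinearMap.adjoint J.toLinearMap k)) := rfl
  rw [h1, key, map_sum]
  simp only [map_smul, LinearMap.adjoint_inner_right]
  simp

end Embed

/-- The sum is the projection onto the span of the mutually orthogonal ranges. -/
lemma sum_comp_adjoint_le_one {ι K : Type*} [Fintype ι] {E : ι → Type*}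
    [∀ i, NormedAddCommGroup (E i)] [∀ i, InnerProductSpace ℂ (E i)] [∀ i, CompleteSpace (E i)]
    [NormedAddCommGroup K] [InnerProductSpace ℂ K] [CompleteSpace K]
    (B : ∀ i, E i →ₗᵢ[ℂ] K) (hB : OrthogonalFamily ℂ E B) :
    ∑ i, (B i).toContinuousLinearMap ∘L
      ContinuousLinearMap.adjoint (B i).toContinuousLinearMap ≤ 1 := by
  classical
  refine IsStarProjection.le_one ⟨?_, ?_⟩
  · rw [IsIdempotentElem, Finset.sum_mul]
    refine Finset.sum_congr rfl fun i _ => ?_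
    rw [Finset.mul_sum, Finset.sum_eq_single i]
    · ext k
      have : ContinuousLinearMap.adjoint (B i).toContinuousLinearMap
          (B i (ContinuousLinearMap.adjoint (B i).toContinuousLinearMap k)) =
          ContinuousLinearMap.adjoint (B i).toContinuousLinearMap k := by
        refine ext_inner_left ℂ fun y => ?_
        rw [ContinuousLinearMap.adjoint_inner_right]
        exact (B i).inner_map_map _ _
      exact congrArg (B i) this
    · intro j _ hj
      ext k
      have : ContinuousLinearMap.adjoint (B i).toContinuousLinearMap
          (B j (ContinuousLinearMap.adjoint (B j).toContinuousLinearMap k)) = 0 := by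
        refine ext_inner_left ℂ fun y => ?_
        rw [ContinuousLinearMap.adjoint_inner_right, inner_zero_right]
        exact hB hj.symm _ _
      exact (congrArg (B i) this).trans (map_zero _)
    · simp
  · rw [isSelfAdjoint_iff, star_sum]
    refine Finset.sum_congr rfl fun i _ => ?_
    rw [ContinuousLinearMap.star_eq_adjoint, ContinuousLinearMap.adjoint_comp,
      ContinuousLinearMap.adjoint_adjoint]

lemma component_eq_of_mul_ne_zero {Θ A : Type*} [Mul A] [Zero A] {L : Θ → A} {a b : Θ}
    (h : L a * L b ≠ 0) : component L a = component L b := by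
  by_cases hab : a = b
  · rw [hab]
  · refine SimpleGraph.ConnectedComponent.sound (SimpleGraph.Adj.reachable ?_)
    rw [productGraph, SimpleGraph.fromRel_adj]
    exact ⟨hab, Or.inl h⟩

/-! ### Necessity: mutually orthogonal blocks. -/

theorem exists_blocks_of_cp {Θ H K : Type*}
    [NormedAddCommGroup H] [InnerProductSpace ℂ H] [CompleteSpace H] [FiniteDimensional ℂ H]
    [NormedAddCommGroup K] [InnerProductSpace ℂ K] [CompleteSpace K] [FiniteDimensional ℂ K]
    (u : Θ → H) (L : Θ → H →L[ℂ] H) (M : Θ → K →L[ℂ] K)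
    (hL : ∀ θ, L θ = rankOne ℂ (u θ) (u θ))
    (hM : ∀ θ, ∃ (c : ℝ) (P : K →L[ℂ] K), 0 ≤ c ∧ IsStarProjection P ∧ M θ = (c : ℂ) • P)
    (hnorm : ∀ θ, ‖L θ‖ = ‖M θ‖)
    (Λ : (H →L[ℂ] H) →CP (K →L[ℂ] K)) (hΛ : Λ 1 ≤ 1) (hΛM : ∀ θ, Λ (L θ) = M θ) :
    ∃ (n : ℕ) (v : Θ → EuclideanSpace ℂ (Fin n)) (d : Component L → ℕ)
      (J : ∀ κ : Component L,
        (blockSpan L v κ ⊗[ℂ] EuclideanSpace ℂ (Fin (d κ))) →ₗᵢ[ℂ] K),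
      UnitarilyEquivalent u v ∧
      (∀ κ, 0 < d κ) ∧
      OrthogonalFamily ℂ
        (fun κ => blockSpan L v κ ⊗[ℂ] EuclideanSpace ℂ (Fin (d κ))) J ∧
      ∀ θ, (M θ).toLinearMap =
        embedOp (J (component L θ))
          (rankOneTensorId (blockVec L v θ) (d (component L θ))) := by
  have hdom (θ : Θ) : MulRight Λ (L θ) := by
    rw [hL]
    exact mulRight_rankOne_self hΛ _ (by rw [← hL, hΛM]; exact hM θ) (by rw [← hL, hΛM, hnorm])
  have h0 (θ : Θ) (h : Λ (L θ) = 0) : u θ = 0 := by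
    have := hnorm θ
    rw [← hΛM, h, norm_zero, norm_eq_zero, hL] at this
    simpa using this
  let T := (stdOrthonormalBasis ℂ H).repr
  choose d J hd hJ using exists_block hL hdom h0 T
  refine ⟨_, fun θ => T (u θ), d, J, unitarilyEquivalent_comp u T, hd, ?_, fun θ => ?_⟩
  · intro κ κ' hne z w
    have hrange (κ : Component L) (θ : Θ) (h : component L θ = κ)
        (c : EuclideanSpace ℂ (Fin (d κ))) :
        ∃ a, J κ (⟨T (u θ), Submodule.subset_span ⟨θ, h, rfl⟩⟩ ⊗ₜ c) = M θ a := by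
      obtain ⟨a, ha⟩ := exists_embedOp_eq (J κ) ⟨T (u θ), Submodule.subset_span ⟨θ, h, rfl⟩⟩ c
      refine ⟨a, ha.trans ?_⟩
      rw [← hΛM]
      exact (LinearMap.congr_fun (hJ κ θ h) a).symm
    have hprod (θ θ' : Θ) (h : component L θ ≠ component L θ') (a b : K) :
        inner ℂ (M θ a) (M θ' b) = 0 := by
      have h1 : ContinuousLinearMap.adjoint (M θ) = M θ := by
        rw [← hΛM, ← ContinuousLinearMap.star_eq_adjoint, ← map_star, hL,
          ContinuousLinearMap.star_eq_adjoint, InnerProductSpace.adjoint_rankOne]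
      -- Multiplicativity turns this product into `Λ (L θ * L θ')`, and that argument vanishes
      -- across components.
      have h2 : M θ * M θ' = 0 := by
        rw [← hΛM, ← hΛM, ← hdom θ' (L θ)]
        by_contra hcon
        exact h (component_eq_of_mul_ne_zero fun h3 => hcon (by rw [h3, map_zero]))
      rw [← ContinuousLinearMap.adjoint_inner_right, h1]
      have h3 : M θ (M θ' b) = 0 := DFunLike.congr_fun h2 b
      rw [h3, inner_zero_right]
    refine block_tensor_induction (p := fun z => inner ℂ (J κ z) (J κ' w) = 0) L _ κ
      ((congrArg (fun t => inner ℂ t (J κ' w)) (J κ).map_zero).trans (inner_zero_left _)) (fun x y hx hy => ?_) (fun θ hθ c => ?_) z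
    · simp only [map_add, inner_add_left, hx, hy, add_zero]
    refine block_tensor_induction (p := fun w => inner ℂ (J κ _) (J κ' w) = 0) L _ κ'
      ((congrArg (fun t => inner ℂ (J κ _) t) (J κ').map_zero).trans (inner_zero_right _)) (fun x y hx hy => ?_) (fun θ' hθ' c' => ?_) w
    · simp only [map_add, inner_add_right, hx, hy, add_zero]
    obtain ⟨a, ha⟩ := hrange κ θ hθ c
    obtain ⟨b, hb⟩ := hrange κ' θ' hθ' c'
    rw [ha, hb]
    exact hprod θ θ' (by rwa [hθ, hθ']) a b
  · rw [← hΛM]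
    exact hJ _ θ rfl

/-! ### Sufficiency: Kraus operators from the blocks. -/

lemma exists_blockIsometry {Θ A H G : Type*} [Mul A] [Zero A] [NormedAddCommGroup H]
    [InnerProductSpace ℂ H] [NormedAddCommGroup G] [InnerProductSpace ℂ G] (L : Θ → A)
    {u : Θ → H} {v : Θ → G} (h : UnitarilyEquivalent u v) (κ : Component L) :
    ∃ V : blockSpan L v κ →ₗᵢ[ℂ] H, ∀ θ (hθ : component L θ = κ),
      V ⟨v θ, Submodule.subset_span ⟨θ, hθ, rfl⟩⟩ = u θ := by
  obtain ⟨W, hW⟩ := h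
  have hle : blockSpan L v κ ≤ Submodule.span ℂ (Set.range v) :=
    Submodule.span_mono (Set.image_subset_range _ _)
  let i : blockSpan L v κ →ₗᵢ[ℂ] Submodule.span ℂ (Set.range v) :=
    ⟨Submodule.inclusion hle, fun x => rfl⟩
  refine ⟨(Submodule.subtypeₗᵢ _).comp (W.symm.toLinearIsometry.comp i), fun θ hθ => ?_⟩
  have : W.symm ⟨v θ, hle (Submodule.subset_span ⟨θ, hθ, rfl⟩)⟩ =
      ⟨u θ, Submodule.subset_span (Set.mem_range_self θ)⟩ := by
    rw [LinearIsometryEquiv.symm_apply_eq]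
    exact Subtype.ext (hW θ).symm
  exact congrArg Subtype.val this

theorem exists_cp_of_blocks {Θ H K : Type*} [Finite Θ]
    [NormedAddCommGroup H] [InnerProductSpace ℂ H] [CompleteSpace H] [FiniteDimensional ℂ H]
    [NormedAddCommGroup K] [InnerProductSpace ℂ K] [CompleteSpace K] [FiniteDimensional ℂ K]
    {G : Type*} [NormedAddCommGroup G] [InnerProductSpace ℂ G] [FiniteDimensional ℂ G]
    (u : Θ → H) (L : Θ → H →L[ℂ] H) (M : Θ → K →L[ℂ] K)
    (hL : ∀ θ, L θ = rankOne ℂ (u θ) (u θ))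
    (v : Θ → G) (d : Component L → ℕ)
    (J : ∀ κ : Component L,
      (blockSpan L v κ ⊗[ℂ] EuclideanSpace ℂ (Fin (d κ))) →ₗᵢ[ℂ] K)
    (huv : UnitarilyEquivalent u v)
    (hJ : OrthogonalFamily ℂ
      (fun κ => blockSpan L v κ ⊗[ℂ] EuclideanSpace ℂ (Fin (d κ))) J)
    (hM : ∀ θ, (M θ).toLinearMap =
      embedOp (J (component L θ)) (rankOneTensorId (blockVec L v θ) (d (component L θ)))) :
    ∃ Λ : (H →L[ℂ] H) →CP (K →L[ℂ] K), Λ 1 ≤ 1 ∧ ∀ θ, Λ (L θ) = M θ := by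
  classical
  have : Finite (Component L) := Quot.finite _
  have := Fintype.ofFinite (Component L)
  have hcomp (κ : Component L) : CompleteSpace (blockSpan L v κ) := FiniteDimensional.complete ℂ _
  choose V hV using exists_blockIsometry L huv
  let B (a : Σ κ, Fin (d κ)) : blockSpan L v a.1 →ₗᵢ[ℂ] K :=
    sliceIsometry (J a.1) (EuclideanSpace.single a.2 1) (by simp)
  have hB (a : Σ κ, Fin (d κ)) (x) : B a x = J a.1 (x ⊗ₜ EuclideanSpace.single a.2 1) := rfl
  have hBo : OrthogonalFamily ℂ (fun a : Σ κ, Fin (d κ) => blockSpan L v a.1) B := by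
    rintro ⟨κ, i⟩ ⟨κ', j⟩ hne x y
    rw [hB, hB]
    by_cases hκ : κ = κ'
    · subst hκ
      have hij : j ≠ i := fun h => hne (by rw [h])
      have h0 : inner ℂ (EuclideanSpace.single i (1 : ℂ)) (EuclideanSpace.single j (1 : ℂ)) =
          (0 : ℂ) := by
        rw [EuclideanSpace.inner_single_left]
        simp [hij.symm]
      exact (inner_map_tmul _ _ _ _ _).trans (by rw [h0, mul_zero])
    · exact hJ hκ _ _
  let V' (κ) := ContinuousLinearMap.adjoint (V κ).toContinuousLinearMap
  have hV'V (κ) (x : blockSpan L v κ) : V' κ (V κ x) = x := by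
    refine ext_inner_left ℂ fun y => ?_
    rw [ContinuousLinearMap.adjoint_inner_right]
    exact (V κ).inner_map_map _ _
  have hV'u (θ) : V' (component L θ) (u θ) = blockVec L v θ := by
    rw [← hV (component L θ) θ rfl, hV'V]
    rfl
  have hV'0 (κ) (θ) (h : κ ≠ component L θ) : V' κ (u θ) = 0 := by
    refine ext_inner_left ℂ fun y => ?_
    rw [ContinuousLinearMap.adjoint_inner_right, inner_zero_right]
    change inner ℂ (V κ y) (u θ) = 0
    obtain ⟨y, hy⟩ := y
    induction hy using Submodule.span_induction with
    | mem x hx =>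
      obtain ⟨θ', hθ', rfl⟩ := hx
      rw [hV κ θ' hθ']
      by_contra hne
      have h1 : component L θ' = component L θ := by
        refine component_eq_of_mul_ne_zero ?_
        rw [hL, hL, rankOne_mul_rankOne]
        refine smul_ne_zero hne (InnerProductSpace.rankOne_ne_zero ?_ ?_)
        · rintro h0; simp [h0] at hne
        · rintro h0; simp [h0] at hne
      exact h (hθ'.symm.trans h1)
    | zero => exact (congrArg (fun t => inner ℂ t (u θ)) (V κ).map_zero).trans (inner_zero_left _)
    | add x y hx hy h1 h2 =>
      refine (congrArg (fun t => inner ℂ t (u θ)) ((V κ).map_add ⟨x, hx⟩ ⟨y, hy⟩)).trans ?_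
      rw [inner_add_left, h1, h2, add_zero]
    | smul a x hx h1 =>
      refine (congrArg (fun t => inner ℂ t (u θ)) ((V κ).map_smul a ⟨x, hx⟩)).trans ?_
      rw [inner_smul_left, h1, mul_zero]
  let A (a : Σ κ, Fin (d κ)) : H →L[ℂ] K := (B a).toContinuousLinearMap ∘L V' a.1
  refine ⟨CompletelyPositiveMap.ofKraus A, ?_, fun θ => ?_⟩
  · rw [CompletelyPositiveMap.ofKraus_apply]
    -- Since `V† V = 1` on each block, `A A†` collapses to `B B†`.
    refine le_of_eq_of_le (Finset.sum_congr rfl fun a _ => ?_) (sum_comp_adjoint_le_one B hBo)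
    ext k
    have h1 : ContinuousLinearMap.adjoint (A a) k =
        V a.1 (ContinuousLinearMap.adjoint (B a).toContinuousLinearMap k) := by
      simp only [A, V']
      rw [ContinuousLinearMap.adjoint_comp, ContinuousLinearMap.adjoint_adjoint]
      rfl
    change B a (V' a.1 (ContinuousLinearMap.adjoint (A a) k)) = _
    rw [h1, hV'V]
    rfl
  · rw [CompletelyPositiveMap.ofKraus_apply, ← ContinuousLinearMap.coe_inj, hM θ,
      embedOp_rankOneTensorId, ContinuousLinearMap.coe_inj, Fintype.sum_sigma,
      Finset.sum_eq_single (component L θ)]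
    · refine Finset.sum_congr rfl fun i _ => ?_
      rw [hL, InnerProductSpace.rankOne_comp, InnerProductSpace.comp_rankOne,
        ContinuousLinearMap.adjoint_adjoint]
      have : A ⟨component L θ, i⟩ (u θ) =
          J _ (blockVec L v θ ⊗ₜ EuclideanSpace.single i 1) := by
        rw [← hV'u]
        rfl
      rw [this]
    · intro κ _ hκ
      refine Finset.sum_eq_zero fun i _ => ?_
      rw [hL, InnerProductSpace.rankOne_comp, InnerProductSpace.comp_rankOne]
      have : A ⟨κ, i⟩ (u θ) = 0 := by
        change B ⟨κ, i⟩ (V' κ (u θ)) = 0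
        rw [hV'0 κ θ hκ]
        exact (B ⟨κ, i⟩).map_zero
      simp [this]
    · simp

end ObsConv

theorem mainTheorem9 {Θ : Type*} [Finite Θ]
    {H : Type*} [NormedAddCommGroup H] [InnerProductSpace ℂ H] [CompleteSpace H]
    [FiniteDimensional ℂ H]
    {K : Type*} [NormedAddCommGroup K] [InnerProductSpace ℂ K] [CompleteSpace K]
    [FiniteDimensional ℂ K]
    (u : Θ → H) (L : Θ → H →L[ℂ] H) (M : Θ → K →L[ℂ] K)
    (hL : ∀ θ, L θ = InnerProductSpace.rankOne ℂ (u θ) (u θ))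
    (hM : ∀ θ, ∃ (c : ℝ) (P : K →L[ℂ] K), 0 ≤ c ∧ IsStarProjection P ∧ M θ = (c : ℂ) • P)
    (hnorm : ∀ θ, ‖L θ‖ = ‖M θ‖) :
    (∃ Λ : (H →L[ℂ] H) →CP (K →L[ℂ] K), Λ 1 ≤ 1 ∧ ∀ θ, Λ (L θ) = M θ) ↔
    (∃ (n : ℕ) (v : Θ → EuclideanSpace ℂ (Fin n)) (d : ObsConv.Component L → ℕ)
      (J : ∀ κ : ObsConv.Component L,
        (ObsConv.blockSpan L v κ ⊗[ℂ] EuclideanSpace ℂ (Fin (d κ))) →ₗᵢ[ℂ] K),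
      ObsConv.UnitarilyEquivalent u v ∧
      (∀ κ, 0 < d κ) ∧
      OrthogonalFamily ℂ
        (fun κ => ObsConv.blockSpan L v κ ⊗[ℂ] EuclideanSpace ℂ (Fin (d κ))) J ∧
      ∀ θ, (M θ).toLinearMap =
        ObsConv.embedOp (J (ObsConv.component L θ))
          (ObsConv.rankOneTensorId (ObsConv.blockVec L v θ) (d (ObsConv.component L θ)))) := by
  constructor
  · rintro ⟨Λ, hΛ, hΛM⟩
    exact ObsConv.exists_blocks_of_cp u L M hL hM hnorm Λ hΛ hΛM
  · rintro ⟨n, v, d, J, huv, -, hJ, hMJ⟩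
    exact ObsConv.exists_cp_of_blocks u L M hL v d J huv hJ hMJ
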